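/- **Privacy guarantee of SIMD-PAC-DB.** *Setting.* A database $\mathbb{I}$ has a privacy-unit (PU) table $U$ with primary key $pk$; a base relation is sensitive if it has a foreign-key path to $U$. A supported query is $Q=\pi_{G;\,e_1,\dots,e_r}\big(\gamma_{G;\mathsf{Aggs}}(\mathcal{T}(\mathbb{I}))\big)$ with real-valued scalar expressions $e_i$ and aggregates among sum, count, avg, min, max. Here $\mathcal{T}$ is built by arbitrary nesting from sensitive base relations with (i) relational algebra that does not combine tuples belonging to different PUs, and (ii) sub-expressions $\pi_{\mathsf{cols}(T^2)}\big(\sigma_p(T^2\;\mathsf{Join}_{G_1}\;\gamma_{G_1;\mathsf{Aggs}_1}(T^1))\big)$, the join being an inner join, a left outer join, or (for $G_1=\emptyset$) a Cartesian product. SIMD-PAC-DB draws a hash key $K$. Each row owned by the PU with key $u$ gets the bit vector $\mathsf{pu}=\mathsf{pac\_hash}_K(u)\in\{0,1\}^m$, $m\ge 1$, so that the implicit samples are $S_j=\{u\in U:\mathsf{pac\_hash}_K(pk)[j]=1\}$. The column $\mathsf{pu}$ is propagated through $\mathcal{T}$. Each aggregation over a sensitive relation is replaced by the vector of the $m$ aggregates,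 the $j$-th one taken over the rows with $\mathsf{pu}[j]=1$. Each selection on inner aggregates in (ii) is replaced by $\mathsf{pu}\leftarrow\mathsf{pu}\wedge\vec p$, with $\vec p$ the componentwise evaluation of $p$, followed by removal of the rows with $\mathsf{pu}=0$. Each $e_i$ is evaluated componentwise. So every cell of the result table (one per output row and expression $e_i$) carries a vector $y\in\mathbb{R}^m$. Let $c$ be the number of these cells. A secret index $j^*$ is drawn uniformly from $\{1,\dots,m\}$, the state $P$ is initialized to the uniform distribution, and the cells are processed one after the other in an arbitrary fixed order. With per-cell budget $B>0$, put $\Delta=\mathrm{Var}_{j\sim P}[y_j]/(2B)$, release $\tilde y=y_{j^*}+\mathcal{N}(0,\Delta)$ with fresh independent noise and, if $\Delta>0$, replace $P_j$ by $P_jW_j/\sum_i P_iW_i$, where $W_j=\exp(-(\tilde y-y_j)^2/(2\Delta))$ (if $\Delta=0$, $P$ is kept). The table of the released values is $\mathsf{Output}$. *Attacks.* The informed adversary knows everything except $j^*$ and the noise, in particular $(S_1,\dots,S_m)$. An inference attack is given by a set of answers and, for each index $j$, the measurable set of the answers that count as success when $j^*=j$. The prior success rate $1-\delta_0$ is the supremum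 of the success probability over all (possibly randomized) answers given without observing $\mathsf{Output}$. The posterior success rate $1-\delta_A$ of an adversary $A$ is the success probability of its (possibly randomized) answer computed from $\mathsf{Output}$. *Statement.* For every database, supported query, realization of the hash key, processing order, $B>0$ and inference attack, $$D_{\mathrm{KL}}\big(\mathbf 1_{1-\delta_A}\,\big\|\,\mathbf 1_{1-\delta_0}\big)\;\le\;\mathrm{MI}\big(j^*;\mathsf{Output}\big)\;\le\;cB ,$$ where $\mathbf 1_p$ is the Bernoulli law with parameter $p$ and KL divergence and mutual information are in nats. The first inequality holds for every adversary $A$ with $1-\delta_A\ge 1-\delta_0$, and also when $1-\delta_A$ is the optimal posterior success rate, i.e. the supremum over all adversaries. -/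

import Mathlib

namespace SimdPac

open MeasureTheory ProbabilityTheory
open scoped ENNReal Classical

noncomputable section

/-! ### Values, tuples, aggregation functions -/

/-- SQL scalars (`null`, a number, or a text value). -/
inductive Scalar : Type
  | null : Scalar
  | num : ℝ → Scalar
  | text : String → Scalar

/-- Tuples with `n` attributes; relations are multisets of tuples (bag semantics). -/
abbrev Tuple (n : ℕ) : Type := Fin n → Scalar

/-- SQL equality of two attribute lists: `NULL` is equal to nothing. -/
def KeyEq {k : ℕ} (a b : Tuple k) : Prop := ∀ i, a i = b i ∧ a i ≠ Scalar.null

inductive AggFun : Type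
  | sum | count | avg | min | max

/-- Value of an aggregation function on the bag of (non-`NULL`) argument values. As in SQL, every
aggregate other than `count` is `NULL` on the empty bag. -/
def AggFun.eval (f : AggFun) (s : Multiset ℝ) : Scalar :=
  match f with
  | .count => .num (s.card : ℝ)
  | .sum => if s = 0 then .null else .num s.sum
  | .avg => if s = 0 then .null else .num (s.sum / (s.card : ℝ))
  | .min => if h : s.toFinset.Nonempty then .num (s.toFinset.min' h) else .null
  | .max => if h : s.toFinset.Nonempty then .num (s.toFinset.max' h) else .null

/-- An aggregate `agg(e(cols))` over relations with `n` attributes: `e` is an arbitrary scalar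
expression, `none` meaning `NULL` (such values are skipped, as in SQL). -/
structure AggExpr (n : ℕ) where
  fn : AggFun
  arg : Tuple n → Option ℝ

def AggExpr.eval {n : ℕ} (a : AggExpr n) (T : Multiset (Tuple n)) : Scalar :=
  a.fn.eval (T.filterMap a.arg)

/-- The group keys produced by `γ_G`: the `G`-values that occur; one single group if `G` is empty
(a global aggregate returns one row even on empty input). -/
def groupKeys {n g : ℕ} (G : Fin g → Fin n) (T : Multiset (Tuple n)) : Finset (Tuple g) :=
  if g = 0 then {fun _ => Scalar.null} else (T.map fun t => t ∘ G).toFinset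

/-- Ordinary `γ_{G;Aggs}`. -/
def groupBy {n g d : ℕ} (G : Fin g → Fin n) (aggs : Fin d → AggExpr n)
    (T : Multiset (Tuple n)) : Multiset (Tuple (g + d)) :=
  (groupKeys G T).val.map fun key =>
    Fin.append key fun a => (aggs a).eval (T.filter fun t => t ∘ G = key)

/-- Ordinary left outer join `A ⟕_θ B`. -/
def leftOuterJoin {n k : ℕ} (θ : Tuple n → Tuple k → Bool) (A : Multiset (Tuple n))
    (B : Multiset (Tuple k)) : Multiset (Tuple (n + k)) :=
  A.bind fun t =>
    if B.filter (fun u => θ t u) = 0 then {Fin.append t fun _ => Scalar.null}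
    else (B.filter fun u => θ t u).map fun u => Fin.append t u

/-! ### Schemas, foreign-key paths to the PU table -/

/-- Base relations with their arities, and the privacy-unit (PU) table with its primary key. -/
structure BaseSchema where
  Rel : Type
  arity : Rel → ℕ
  puTable : Rel
  keyArity : ℕ
  puKey : Fin keyArity → Fin (arity puTable)

/-- A foreign-key path from a relation to the PU table: a chain of links `r.fk = r'.pk`. -/
inductive FKPath (S : BaseSchema) : S.Rel → Type
  | here : FKPath S S.puTable
  | step {r r' : S.Rel} {k : ℕ} (fk : Fin k → Fin (S.arity r)) (pk : Fin k → Fin (S.arity r'))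
      (rest : FKPath S r') : FKPath S r

/-- A schema: the sensitive base relations are those with a foreign-key path to the PU table. -/
structure Schema extends BaseSchema where
  path : (r : Rel) → Option (FKPath toBaseSchema r)
  path_puTable : path puTable = some FKPath.here

/-- A set `𝕀` of base relations over the schema. -/
abbrev Instance (S : BaseSchema) : Type := (r : S.Rel) → Multiset (Tuple (S.arity r))

/-- The join of a sensitive base relation with the PU table along its foreign-key path, projected
on the attributes of the relation and the primary key of the PU. -/
def FKPath.link {S : BaseSchema} (I : Instance S) :
    {r : S.Rel} → FKPath S r → Multiset (Tuple (S.arity r) × Tuple S.keyArity)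
  | _, .here => (I S.puTable).map fun u => (u, u ∘ S.puKey)
  | r, .step fk pk rest =>
      (I r).bind fun t =>
        ((rest.link I).filter fun x => KeyEq (t ∘ fk) (x.1 ∘ pk)).map fun x => (t, x.2)

/-! ### The query class -/

/-- Relational algebra over the base relations that are not linked to the PU table. Predicates and
scalar expressions are arbitrary functions of the tuple. -/
inductive PubQuery (S : Schema) : ℕ → Type
  | base (r : S.Rel) (h : S.path r = none) : PubQuery S (S.arity r)
  | select {n : ℕ} (p : Tuple n → Bool) (T : PubQuery S n) : PubQuery S n
  | project {n k : ℕ} (e : Tuple n → Tuple k) (T : PubQuery S n) : PubQuery S k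
  | join {n k : ℕ} (θ : Tuple n → Tuple k → Bool) (A : PubQuery S n) (B : PubQuery S k) :
      PubQuery S (n + k)
  | leftJoin {n k : ℕ} (θ : Tuple n → Tuple k → Bool) (A : PubQuery S n) (B : PubQuery S k) :
      PubQuery S (n + k)
  | union {n : ℕ} (A B : PubQuery S n) : PubQuery S n
  | diff {n : ℕ} (A B : PubQuery S n) : PubQuery S n
  | distinct {n : ℕ} (T : PubQuery S n) : PubQuery S n
  | groupBy {n g d : ℕ} (G : Fin g → Fin n) (aggs : Fin d → AggExpr n) (T : PubQuery S n) :
      PubQuery S (g + d)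

/-- Ordinary evaluation. -/
def PubQuery.eval {S : Schema} (I : Instance S.toBaseSchema) :
    {n : ℕ} → PubQuery S n → Multiset (Tuple n)
  | _, .base r _ => I r
  | _, .select p T => (T.eval I).filter fun t => p t
  | _, .project e T => (T.eval I).map e
  | _, .join θ A B =>
      (A.eval I).bind fun t => ((B.eval I).filter fun u => θ t u).map fun u => Fin.append t u
  | _, .leftJoin θ A B => leftOuterJoin θ (A.eval I) (B.eval I)
  | _, .union A B => A.eval I + B.eval I
  | _, .diff A B => (A.eval I).dedup.filter fun t => t ∉ B.eval I
  | _, .distinct T => (T.eval I).dedup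
  | _, .groupBy G aggs T => SimdPac.groupBy G aggs (T.eval I)

/-- The join of sub-expression `E`: an equi-join on `G₁`, inner (a Cartesian product when `G₁` is
empty) or left outer. -/
inductive JoinKind : Type
  | inner | leftOuter

/-- The sub-queries `𝒯` over sensitive relations. All constructors but the last are the operators of
`F`: relational algebra that does not combine tuples of different PUs, i.e. binary operators between
two sensitive inputs, duplicate elimination and aggregation act within each PU separately, whereas
inputs that are not sensitive may be used freely. The last one is
`E = π_{cols(T²)}(σ_p(T² Join_{G₁} γ_{G₁;Aggs₁}(T¹)))`, whose inner aggregation may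
range over many PUs. -/
inductive SubQuery (S : Schema) : ℕ → Type
  | base (r : S.Rel) (c : FKPath S.toBaseSchema r) (h : S.path r = some c) : SubQuery S (S.arity r)
  | select {n : ℕ} (p : Tuple n → Bool) (T : SubQuery S n) : SubQuery S n
  | project {n k : ℕ} (e : Tuple n → Tuple k) (T : SubQuery S n) : SubQuery S k
  | joinPub {n k : ℕ} (θ : Tuple n → Tuple k → Bool) (A : SubQuery S n) (B : PubQuery S k) :
      SubQuery S (n + k)
  | join {n k : ℕ} (θ : Tuple n → Tuple k → Bool) (A : SubQuery S n) (B : SubQuery S k) :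
      SubQuery S (n + k)
  | leftJoinPub {n k : ℕ} (θ : Tuple n → Tuple k → Bool) (A : SubQuery S n) (B : PubQuery S k) :
      SubQuery S (n + k)
  | leftJoin {n k : ℕ} (θ : Tuple n → Tuple k → Bool) (A : SubQuery S n) (B : SubQuery S k) :
      SubQuery S (n + k)
  | union {n : ℕ} (A B : SubQuery S n) : SubQuery S n
  | diffPub {n : ℕ} (A : SubQuery S n) (B : PubQuery S n) : SubQuery S n
  | diff {n : ℕ} (A B : SubQuery S n) : SubQuery S n
  | distinct {n : ℕ} (T : SubQuery S n) : SubQuery S n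
  | groupByPU {n g d : ℕ} (G : Fin g → Fin n) (aggs : Fin d → AggExpr n) (T : SubQuery S n) :
      SubQuery S (g + d)
  | nested {n k g d : ℕ} (kind : JoinKind) (G₂ : Fin g → Fin n) (G₁ : Fin g → Fin k)
      (aggs : Fin d → AggExpr k) (p : Tuple n → Tuple d → Bool)
      (T₂ : SubQuery S n) (T₁ : SubQuery S k) : SubQuery S n

/-- The query class `𝒬`: `Q = π_{G; e₁, …, e_c}(γ_{G;Aggs}(𝒯(𝕀)))`. The `eᵢ` are arbitrary real-valued
scalar expressions of the grouping attributes and of the aggregates. -/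
structure Query (S : Schema) where
  {n g d c : ℕ}
  T : SubQuery S n
  G : Fin g → Fin n
  aggs : Fin d → AggExpr n
  exprs : Fin c → Tuple g → Tuple d → ℝ

/-! ### The operators of SIMD-PAC-DB -/

/-- A row of a sensitive relation with its PU hash column `pu ∈ {0,1}^m`; `key` is the primary key of
the PU that owns the row (`k` attributes). -/
structure PURow (k m n : ℕ) where
  data : Tuple n
  key : Tuple k
  pu : Fin m → Bool

section Operators

variable {k m n : ℕ}

/-- `pac_select(pu, p⃗)`: bitwise AND. -/
def pacSelect (pu p : Fin m → Bool) : Fin m → Bool := fun j => pu j && p j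

/-- `pac_agg(pu, e(cols))`: component `j` aggregates the rows with `pu[j] = 1`. -/
def pacAgg (a : AggExpr n) (T : Multiset (PURow k m n)) : Fin m → Scalar :=
  fun j => a.eval ((T.filter fun r => r.pu j = true).map PURow.data)

/-- The vector-lifted expression `e⃗`: pointwise application of `e` to vector-valued columns. -/
def vecLift {ι α β : Type} (e : (ι → α) → β) (cols : ι → Fin m → α) : Fin m → β :=
  fun j => e fun i => cols i j

/-- `γ_{G;pac_agg}`, at one group key. -/
def pacGroup {g d : ℕ} (G : Fin g → Fin n) (aggs : Fin d → AggExpr n)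
    (T : Multiset (PURow k m n)) (key : Tuple g) : Fin d → Fin m → Scalar :=
  fun a => pacAgg (aggs a) (T.filter fun r => r.data ∘ G = key)

/-- `σ_{pu ≠ 0}`. -/
def dropEmpty (T : Multiset (PURow k m n)) : Multiset (PURow k m n) :=
  T.filter fun r => ∃ j, r.pu j = true

/-- The worlds in which the tuple `t` of the privacy unit `u` is present. -/
def worlds (T : Multiset (PURow k m n)) (t : Tuple n) (u : Tuple k) : Fin m → Bool :=
  fun j => decide (∃ r ∈ T, r.data = t ∧ r.key = u ∧ r.pu j = true)

/-- Distinct pairs of a tuple and its PU. -/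
def dataKeys (T : Multiset (PURow k m n)) : Multiset (Tuple n × Tuple k) :=
  (T.map fun r => (r.data, r.key)).dedup

/-- Inner join of two sensitive relations within each PU; a joined row is present in the worlds in
which both rows are. -/
def puJoin {l : ℕ} (θ : Tuple n → Tuple l → Bool) (A : Multiset (PURow k m n))
    (B : Multiset (PURow k m l)) : Multiset (PURow k m (n + l)) :=
  dropEmpty <| A.bind fun r =>
    (B.filter fun s => s.key = r.key ∧ θ r.data s.data = true).map fun s =>
      ⟨Fin.append r.data s.data, r.key, pacSelect r.pu s.pu⟩

/-- Rows of `A` padded with `NULL`, present in the worlds in which they have no partner in `B`. -/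
def puPad {l : ℕ} (θ : Tuple n → Tuple l → Bool) (A : Multiset (PURow k m n))
    (B : Multiset (PURow k m l)) : Multiset (PURow k m (n + l)) :=
  dropEmpty <| A.map fun r =>
    ⟨Fin.append r.data fun _ => Scalar.null, r.key,
      pacSelect r.pu fun j =>
        decide (¬ ∃ s ∈ B, s.key = r.key ∧ θ r.data s.data = true ∧ s.pu j = true)⟩

/-- Aggregation with the PU among the grouping attributes: for every group, one row for each value
that the vector of PAC aggregates takes over the worlds in which the group is not empty, present in
exactly these worlds (a single row when all rows of a group have the same `pu`). -/
def puGroupBy {g d : ℕ} (G : Fin g → Fin n) (aggs : Fin d → AggExpr n)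
    (T : Multiset (PURow k m n)) : Multiset (PURow k m (g + d)) :=
  ((T.map fun r => (r.data ∘ G, r.key)).dedup).bind fun x =>
    let Tx := T.filter fun r => r.data ∘ G = x.1 ∧ r.key = x.2
    let vec : Fin m → Tuple d := fun j a => pacAgg (aggs a) Tx j
    let active : Finset (Fin m) := Finset.univ.filter fun j => ∃ r ∈ Tx, r.pu j = true
    (active.image vec).val.map fun v =>
      ⟨Fin.append x.1 v, x.2, fun j => decide (j ∈ active ∧ vec j = v)⟩

/-- The rewritten sub-expression `E`: the inner aggregates become vectors, they are joined to `T²`,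
the predicate is vector-lifted and used to update `pu`, and `σ_{pu ≠ 0}` is applied. -/
def puNested {l g d : ℕ} (kind : JoinKind) (G₂ : Fin g → Fin n) (G₁ : Fin g → Fin l)
    (aggs : Fin d → AggExpr l) (p : Tuple n → Tuple d → Bool)
    (A : Multiset (PURow k m n)) (B : Multiset (PURow k m l)) : Multiset (PURow k m n) :=
  let keys := groupKeys G₁ (B.map PURow.data)
  dropEmpty <| A.bind fun r =>
    let matched := keys.filter fun key => KeyEq (r.data ∘ G₂) key
    let cols : Multiset (Fin d → Fin m → Scalar) :=
      matched.val.map fun key => pacGroup G₁ aggs B key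
    let padded : Multiset (Fin d → Fin m → Scalar) :=
      match kind with
      | .inner => cols
      | .leftOuter => if matched = ∅ then {fun _ _ => Scalar.null} else cols
    padded.map fun v => ⟨r.data, r.key, pacSelect r.pu (vecLift (p r.data) v)⟩

end Operators

/-- Evaluation of the rewritten sub-query `Re^SIMD_{1,2,3}(𝒯(𝕀))`, where `hash` is `pac_hash_K`: every
sensitive base relation gets the hash of its PU as the column `pu`, which is propagated. -/
def SubQuery.simd {S : Schema} (I : Instance S.toBaseSchema) {m : ℕ}
    (hash : Tuple S.keyArity → Fin m → Bool) :
    {n : ℕ} → SubQuery S n → Multiset (PURow S.keyArity m n)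
  | _, .base _ c _ => (c.link I).map fun x => ⟨x.1, x.2, hash x.2⟩
  | _, .select p T => (T.simd I hash).filter fun r => p r.data
  | _, .project e T => (T.simd I hash).map fun r => ⟨e r.data, r.key, r.pu⟩
  | _, .joinPub θ A B => (A.simd I hash).bind fun r =>
      ((B.eval I).filter fun u => θ r.data u).map fun u => ⟨Fin.append r.data u, r.key, r.pu⟩
  | _, .join θ A B => puJoin θ (A.simd I hash) (B.simd I hash)
  | _, .leftJoinPub θ A B => (A.simd I hash).bind fun r =>
      (leftOuterJoin θ {r.data} (B.eval I)).map fun t => ⟨t, r.key, r.pu⟩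
  | _, .leftJoin θ A B =>
      puJoin θ (A.simd I hash) (B.simd I hash) + puPad θ (A.simd I hash) (B.simd I hash)
  | _, .union A B => A.simd I hash + B.simd I hash
  | _, .diffPub A B =>
      ((dataKeys (A.simd I hash)).filter fun x => x.1 ∉ B.eval I).map fun x =>
        ⟨x.1, x.2, worlds (A.simd I hash) x.1 x.2⟩
  | _, .diff A B => dropEmpty <| (dataKeys (A.simd I hash)).map fun x =>
      ⟨x.1, x.2, pacSelect (worlds (A.simd I hash) x.1 x.2)
        fun j => !(worlds (B.simd I hash) x.1 x.2 j)⟩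
  | _, .distinct T => (dataKeys (T.simd I hash)).map fun x =>
      ⟨x.1, x.2, worlds (T.simd I hash) x.1 x.2⟩
  | _, .groupByPU G aggs T => puGroupBy G aggs (T.simd I hash)
  | _, .nested kind G₂ G₁ aggs p T₂ T₁ =>
      puNested kind G₂ G₁ aggs p (T₂.simd I hash) (T₁.simd I hash)

namespace Query

variable {S : Schema} (Q : Query S) (I : Instance S.toBaseSchema) {m : ℕ}
  (hash : Tuple S.keyArity → Fin m → Bool)

/-- The group keys of the output table. They do not depend on the secret index. -/
def outKeys : Finset (Tuple Q.g) := groupKeys Q.G ((Q.T.simd I hash).map PURow.data)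

/-- The released cells of the output table: one for each output row and projected expression. -/
abbrev Cell : Type := ↥(Q.outKeys I hash) × Fin Q.c

/-- The vector in `ℝ^m` that is passed to `pac_noised` for a cell: the vector-lifted expression `e⃗ᵢ`
applied to the PAC aggregates of the group. -/
def cellVec (x : Q.Cell I hash) : Fin m → ℝ :=
  vecLift (Q.exprs x.2 x.1.1) (pacGroup Q.G Q.aggs (Q.T.simd I hash) x.1.1)

end Query

/-! ### The noise mechanism -/

section Noise

variable {m : ℕ}

/-- `Var_{j∼P}[y_j]`. -/
def varianceUnder (P y : Fin m → ℝ) : ℝ := ∑ j, P j * (y j - ∑ i, P i * y i) ^ 2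

/-- `Δ = s² / (2B)`. -/
def noiseVar (B : ℝ) (P y : Fin m → ℝ) : ℝ := varianceUnder P y / (2 * B)

/-- `pac_noised`: the released value `y_{j*} + √Δ z`, where `z` is a standard normal variate, and the
updated state `P`. When `Δ = 0` the vector is constant on the support of `P`, its value is released
without noise, and (as `x / 0 = 0`) the state does not change. -/
def pacNoised (B : ℝ) (jstar : Fin m) (P y : Fin m → ℝ) (z : ℝ) : ℝ × (Fin m → ℝ) :=
  let Δ := noiseVar B P y
  let out := y jstar + Real.sqrt Δ * z
  let W : Fin m → ℝ := fun j => Real.exp (-(out - y j) ^ 2 / (2 * Δ))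
  (out, fun j => P j * W j / ∑ i, P i * W i)

/-- `pac_noised` applied to `N` cells one after the other, threading the state `P`. -/
def noisedCells (B : ℝ) (jstar : Fin m) :
    (N : ℕ) → (Fin m → ℝ) → (Fin N → Fin m → ℝ) → (Fin N → ℝ) → (Fin N → ℝ)
  | 0, _, _, _ => Fin.elim0
  | N + 1, P, y, z =>
      Fin.cons (pacNoised B jstar P (y 0) (z 0)).1
        (noisedCells B jstar N (pacNoised B jstar P (y 0) (z 0)).2
          (fun i => y i.succ) (fun i => z i.succ))

end Noise

namespace Query

variable {S : Schema} (Q : Query S) (I : Instance S.toBaseSchema) {m : ℕ}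
  (hash : Tuple S.keyArity → Fin m → Bool)

/-- The noisy output table of SIMD-PAC-DB (its real cells, indexed by output row and expression) for
secret index `jstar` and noise realization `z`; `order` is the order in which the cells are
processed. -/
def simdOutput (B : ℝ) {N : ℕ} (order : Fin N ≃ Q.Cell I hash) (jstar : Fin m)
    (z : Q.Cell I hash → ℝ) : Q.Cell I hash → ℝ :=
  fun x => noisedCells B jstar N (fun _ => 1 / (m : ℝ)) (fun i => Q.cellVec I hash (order i))
    (fun i => z (order i)) (order.symm x)

/-- The joint law of `(j*, Output)`: `j*` is uniform, the noise is i.i.d. standard normal and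
independent of `j*`. -/
def simdLaw [NeZero m] (B : ℝ) {N : ℕ} (order : Fin N ≃ Q.Cell I hash) :
    Measure (Fin m × (Q.Cell I hash → ℝ)) :=
  (((PMF.uniformOfFintype (Fin m)).toMeasure).prod
      (Measure.pi fun _ : Q.Cell I hash => gaussianReal 0 1)).map
    fun ω => (ω.1, Q.simdOutput I hash B order ω.1 ω.2)

end Query

/-! ### Information and inference attacks -/

/-- Mutual information (in nats) of the two components of a joint law. -/
def mutualInfo {α β : Type*} [MeasurableSpace α] [MeasurableSpace β] (μ : Measure (α × β)) : ℝ≥0∞ :=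
  InformationTheory.klDiv μ (μ.fst.prod μ.snd)

/-- The law of a Bernoulli variable with success probability `p ≤ 1`. -/
def bern (p : ℝ≥0∞) : Measure Bool := p • Measure.dirac true + (1 - p) • Measure.dirac false

/-- `D_KL(𝟏_p ‖ 𝟏_q)`. -/
def bernKL (p q : ℝ≥0∞) : ℝ≥0∞ := InformationTheory.klDiv (bern p) (bern q)

section Attack

variable {m : ℕ} {O A : Type*} [MeasurableSpace O] [MeasurableSpace A]

/-- Posterior success rate, for a joint law `μ` of secret and observation, of an adversary who
answers with a (possibly randomized) function `κ` of the observation; the answer `a` is a success for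
the secret `j` iff `succ j a`. -/
def posteriorRate (μ : Measure (Fin m × O)) (succ : Fin m → A → Prop) (κ : Kernel O A) : ℝ≥0∞ :=
  ∫⁻ x, κ x.2 {a | succ x.1 a} ∂μ

/-- Optimal posterior success rate. -/
def optPosteriorRate (μ : Measure (Fin m × O)) (succ : Fin m → A → Prop) : ℝ≥0∞ :=
  ⨆ κ : {κ : Kernel O A // IsMarkovKernel κ}, posteriorRate μ succ κ.1

/-- Prior success rate: the best success rate of a (possibly randomized) answer given without any
observation, knowing the law of the secret. -/
def priorRate (μ : Measure (Fin m × O)) (succ : Fin m → A → Prop) : ℝ≥0∞ :=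
  ⨆ ν : ProbabilityMeasure A, ∫⁻ j, (ν : Measure A) {a | succ j a} ∂μ.fst

end Attack

end

end SimdPac

/-! Once the hash key is fixed, the query only contributes a fixed vector in `ℝ^m` for each cell;
the theorem concerns the noise mechanism applied to arbitrary fixed vectors.

Upper bound. Mutual information is at most the divergence of the joint law from the product of the
law of `j*` with any reference law of the output (`mutualInfo_le_klDiv_prod`). The reference chosen
is the law of a mechanism that knows no secret: it centres the noise at the mean of the cell under
the current state `P` instead of at `y_{j*}`, with the same variance and the same state update. Both
mechanisms compute the state from the released values alone, so the chain rule splits the divergence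
cell by cell (`klDiv_releaseLaw_succ_le`). One cell compares Gaussians of equal variance `Δ`;
averaged over `P`, their divergence is `Var/(2Δ) = B` (`sum_klDiv_gaussianReal`). Since `P` is the
posterior law of `j*` given the past, Bayes' rule turns the prior average of the remaining cost into
an average, over the released value, of posterior averages, each bounded by induction
(`sum_lintegral_gaussianReal_le`, `sum_klDiv_releaseLaw_le`).

Attack bound. The success bit is the output of a channel applied to (secret, observation), so data
processing bounds the divergence between its laws under the joint law and under the product of the
marginals. Under the product the observation is useless, so success has probability at most the
prior rate; replacing it by the prior rate only lowers the binary divergence (`bernKL_anti_right`).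
Continuity gives the supremum over adversaries. -/

namespace SimdPac

open MeasureTheory ProbabilityTheory
open scoped ENNReal Topology

/-! ### Chain rule and mutual information -/

section Information

open InformationTheory

variable {α β : Type*} {mα : MeasurableSpace α} {mβ : MeasurableSpace β}

/-- Conditional form of the Kullback-Leibler divergence between composition-products. -/
lemma klDiv_compProd_right_eq_lintegral [MeasurableSpace.CountableOrCountablyGenerated α β]
    (μ : Measure α) [IsFiniteMeasure μ] (κ η : Kernel α β) [IsMarkovKernel κ] [IsMarkovKernel η]
    (h : ∀ a, κ a ≪ η a) :
    klDiv (μ ⊗ₘ κ) (μ ⊗ₘ η) = ∫⁻ a, klDiv (κ a) (η a) ∂μ := by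
  have hκ : η.withDensity (κ.rnDeriv η) = κ := by
    ext1 a
    exact Kernel.withDensity_rnDeriv_eq (h a)
  have hac : μ ⊗ₘ κ ≪ μ ⊗ₘ η :=
    Measure.AbsolutelyContinuous.compProd_right (Filter.Eventually.of_forall h)
  have hdens : μ ⊗ₘ κ = (μ ⊗ₘ η).withDensity (fun p => κ.rnDeriv η p.1 p.2) := by
    have : IsSFiniteKernel (η.withDensity (κ.rnDeriv η)) := by rw [hκ]; infer_instance
    conv_lhs => rw [← hκ]
    exact Measure.compProd_withDensity (κ.measurable_rnDeriv η)
  have hrn : (μ ⊗ₘ κ).rnDeriv (μ ⊗ₘ η) =ᵐ[μ ⊗ₘ η] fun p => κ.rnDeriv η p.1 p.2 := by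
    rw [hdens]
    exact Measure.rnDeriv_withDensity _ (κ.measurable_rnDeriv η)
  -- Written with `klFun`, the divergence integrates a nonnegative function, so Tonelli applies
  -- without any integrability hypothesis.
  rw [klDiv_eq_lintegral_klFun_of_ac hac,
    lintegral_congr_ae (g := fun p => ENNReal.ofReal (klFun (κ.rnDeriv η p.1 p.2).toReal))
      (by filter_upwards [hrn] with p hp; rw [hp]), Measure.lintegral_compProd]
  · refine lintegral_congr fun a => ?_
    rw [klDiv_eq_lintegral_klFun_of_ac (h a)]
    refine lintegral_congr_ae ?_
    filter_upwards [κ.rnDeriv_eq_rnDeriv_measure (η := η) (a := a)] with b hb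
    rw [hb]
  · exact ENNReal.measurable_ofReal.comp
      (measurable_klFun.comp (κ.measurable_rnDeriv η).ennreal_toReal)

lemma klDiv_map_measurableEquiv (e : α ≃ᵐ β) (μ ν : Measure α) [IsFiniteMeasure μ]
    [IsFiniteMeasure ν] : klDiv (μ.map e) (ν.map e) = klDiv μ ν := by
  refine le_antisymm (klDiv_map_le _ _ e.measurable) ?_
  calc klDiv μ ν = klDiv ((μ.map e).map e.symm) ((ν.map e).map e.symm) := by simp
    _ ≤ _ := klDiv_map_le _ _ e.symm.measurable

/-- Mutual information is at most the divergence from any product with the same first marginal. -/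
lemma mutualInfo_le_klDiv_prod [StandardBorelSpace α] [Nonempty α] (μ : Measure (α × β))
    [IsProbabilityMeasure μ] (ν : Measure β) [IsProbabilityMeasure ν] :
    mutualInfo μ ≤ klDiv μ (μ.fst.prod ν) := by
  have hswap (ρ : Measure β) [IsProbabilityMeasure ρ] :
      klDiv μ (μ.fst.prod ρ) = klDiv ((μ.map Prod.swap).fst ⊗ₘ (μ.map Prod.swap).condKernel)
        (ρ ⊗ₘ Kernel.const β μ.fst) := by
    have : IsProbabilityMeasure (μ.map Prod.swap) :=
      Measure.isProbabilityMeasure_map measurable_swap.aemeasurable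
    rw [← klDiv_map_measurableEquiv MeasurableEquiv.prodComm, Measure.disintegrate,
      Measure.compProd_const]
    change klDiv (μ.map Prod.swap) ((μ.fst.prod ρ).map Prod.swap) = _
    rw [Measure.prod_swap]
  have : IsProbabilityMeasure (μ.map Prod.swap) :=
    Measure.isProbabilityMeasure_map measurable_swap.aemeasurable
  -- With the observation as first coordinate, the chain rule gives a marginal term plus a
  -- conditional term that does not depend on the reference; the marginal term vanishes for the
  -- reference `μ.snd`.
  rw [mutualInfo, hswap, hswap, klDiv_compProd_eq_add _ ν, klDiv_compProd_eq_add _ μ.snd]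
  refine add_le_add_left ?_ _
  rw [Measure.fst_map_swap]
  simp

end Information

/-! ### Binary relative entropy -/

section Bernoulli

open InformationTheory

lemma measurable_bern : Measurable bern := by
  refine Measure.measurable_of_measurable_coe _ fun s _ => ?_
  simp only [bern, Measure.coe_add, Measure.coe_smul, Pi.add_apply, Pi.smul_apply, smul_eq_mul]
  fun_prop

lemma isProbabilityMeasure_bern {p : ℝ≥0∞} (hp : p ≤ 1) : IsProbabilityMeasure (bern p) :=
  ⟨by simp [bern, add_tsub_cancel_of_le hp]⟩

lemma bernKL_self {p : ℝ≥0∞} (hp : p ≤ 1) : bernKL p p = 0 := by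
  have := isProbabilityMeasure_bern hp
  exact klDiv_self _

lemma bernKL_zero_right {p : ℝ≥0∞} (hp : p ≠ 0) : bernKL p 0 = ∞ := by
  refine klDiv_of_not_ac fun h => hp ?_
  have := h (s := {true}) (by simp [bern])
  simpa [bern] using this

/-- The binary relative entropy of real parameters. -/
noncomputable def binRelEntropy (p q : ℝ) : ℝ :=
  p * Real.log p + (1 - p) * Real.log (1 - p) - p * Real.log q - (1 - p) * Real.log (1 - q)

/-- Expanding the logarithms of quotients leaves only `x log x` terms and terms affine in `p`, so
continuity holds at the endpoints as well. -/
lemma continuous_binRelEntropy_left (q : ℝ) : Continuous fun p => binRelEntropy p q := by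
  unfold binRelEntropy
  have h := Real.continuous_mul_log
  have h2 : Continuous fun p : ℝ => (1 - p) * Real.log (1 - p) :=
    h.comp (continuous_const.sub continuous_id)
  fun_prop

lemma bernKL_eq_ofReal {p q : ℝ≥0∞} (hp : p ≤ 1) (h0 : q ≠ 0) (h1 : q < 1) :
    bernKL p q = ENNReal.ofReal (binRelEntropy p.toReal q.toReal) := by
  have := isProbabilityMeasure_bern hp
  have := isProbabilityMeasure_bern h1.le
  have hq : q ≠ ∞ := h1.ne_top
  have hp' : p ≠ ∞ := (hp.trans_lt ENNReal.one_lt_top).ne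
  have hq1 : 1 - q ≠ 0 := (tsub_pos_of_lt h1).ne'
  have hq1' : 1 - q ≠ ∞ := ENNReal.sub_ne_top ENNReal.one_ne_top
  -- The likelihood ratio of the two Bernoulli laws.
  let f : Bool → ℝ≥0∞ := fun b => if b then p / q else (1 - p) / (1 - q)
  have hdens : bern p = (bern q).withDensity f := by
    classical
    ext s hs
    rw [withDensity_apply _ hs, bern, bern, Measure.restrict_add, lintegral_add_measure,
      Measure.restrict_smul, Measure.restrict_smul, lintegral_smul_measure, lintegral_smul_measure,
      restrict_dirac' hs, restrict_dirac' hs]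
    by_cases ht : true ∈ s <;> by_cases hf : false ∈ s <;>
      simp [ht, hf, f, ENNReal.mul_div_cancel h0 hq, ENNReal.mul_div_cancel hq1 hq1']
  have hac : bern p ≪ bern q := by rw [hdens]; exact withDensity_absolutelyContinuous _ _
  have hrn : (bern p).rnDeriv (bern q) =ᵐ[bern q] f := by
    rw [hdens]; exact Measure.rnDeriv_withDensity _ (measurable_of_countable f)
  have hllr : llr (bern p) (bern q) =ᵐ[bern p] fun b => Real.log (f b).toReal := by
    filter_upwards [hac.ae_le hrn] with b hb
    rw [llr, hb]
  rw [bernKL, klDiv_of_ac_of_integrable hac .of_finite, integral_congr_ae hllr]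
  simp only [probReal_univ, add_sub_cancel_right]
  congr 1
  rw [integral_fintype .of_finite, Fintype.sum_bool]
  have hpr : 0 ≤ p.toReal := ENNReal.toReal_nonneg
  have hqr : 0 < q.toReal := ENNReal.toReal_pos h0 hq
  have hqr1 : 0 < 1 - q.toReal := by
    have := ENNReal.toReal_pos hq1 hq1'
    rwa [ENNReal.toReal_sub_of_le h1.le ENNReal.one_ne_top, ENNReal.toReal_one] at this
  have key (a b : ℝ) (hb : 0 < b) : a * Real.log (a / b) = a * Real.log a - a * Real.log b := by
    rcases eq_or_ne a 0 with rfl | ha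
    · simp
    · rw [Real.log_div ha hb.ne', mul_sub]
  simp only [measureReal_def, bern, Measure.coe_add, Measure.coe_smul, Pi.add_apply, Pi.smul_apply,
    Measure.dirac_apply, Set.indicator, Set.mem_singleton_iff, Pi.one_apply, f, if_true, mul_zero,
    mul_one, add_zero, zero_add, reduceCtorEq, ENNReal.toReal_div,
    ENNReal.toReal_sub_of_le hp ENNReal.one_ne_top,
    ENNReal.toReal_sub_of_le h1.le ENNReal.one_ne_top, ENNReal.toReal_one, smul_eq_mul,
    Bool.false_eq_true, if_false, binRelEntropy]
  rw [key _ _ hqr, key _ _ hqr1]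
  ring

/-- The derivative in `q` is `-(p - q) / (q (1 - q))`, nonpositive for `q ≤ p`. The proof uses `log
t ≤ t - 1` instead of calculus; the boundary values `q' = 0` and `q = 1` are treated apart. -/
lemma bernKL_anti_right {p q q' : ℝ≥0∞} (hp : p ≤ 1) (hqp : q ≤ p) (hq : q' ≤ q) :
    bernKL p q ≤ bernKL p q' := by
  rcases eq_or_ne q' 0 with rfl | h0
  · rcases eq_or_ne p 0 with rfl | hp0
    · rw [nonpos_iff_eq_zero.mp hqp]
    · rw [bernKL_zero_right hp0]; exact le_top
  rcases (hqp.trans hp).eq_or_lt with rfl | h1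
  · rw [le_antisymm hp hqp, bernKL_self le_rfl]; exact zero_le
  have hq0 : q ≠ 0 := fun h => h0 (nonpos_iff_eq_zero.mp (h ▸ hq))
  rw [bernKL_eq_ofReal hp hq0 h1, bernKL_eq_ofReal hp h0 (hq.trans_lt h1)]
  refine ENNReal.ofReal_le_ofReal ?_
  have hp' : p ≠ ∞ := (hp.trans_lt ENNReal.one_lt_top).ne
  have a1 : 0 < q'.toReal := ENNReal.toReal_pos h0 (hq.trans_lt h1).ne_top
  have a2 : q'.toReal ≤ q.toReal := ENNReal.toReal_mono h1.ne_top hq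
  have a3 : q.toReal ≤ p.toReal := ENNReal.toReal_mono hp' hqp
  have a4 : p.toReal ≤ 1 := by
    simpa using ENNReal.toReal_mono ENNReal.one_ne_top hp
  have a5 : q.toReal < 1 := by
    simpa using (ENNReal.toReal_lt_toReal h1.ne_top ENNReal.one_ne_top).2 h1
  generalize p.toReal = x, q.toReal = y, q'.toReal = z at *
  have hy : 0 < y := a1.trans_le a2
  have b1 : Real.log z - Real.log y ≤ z / y - 1 := by
    rw [← Real.log_div a1.ne' hy.ne']
    exact Real.log_le_sub_one_of_pos (by positivity)
  have b2 : Real.log (1 - z) - Real.log (1 - y) ≤ (1 - z) / (1 - y) - 1 := by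
    rw [← Real.log_div (by linarith) (by linarith)]
    exact Real.log_le_sub_one_of_pos (div_pos (by linarith) (by linarith))
  have c1 : x * (Real.log z - Real.log y) ≤ x * (z / y - 1) :=
    mul_le_mul_of_nonneg_left b1 (by linarith)
  have c2 : (1 - x) * (Real.log (1 - z) - Real.log (1 - y)) ≤ (1 - x) * ((1 - z) / (1 - y) - 1) :=
    mul_le_mul_of_nonneg_left b2 (by linarith)
  have c3 : x * (z / y - 1) + (1 - x) * ((1 - z) / (1 - y) - 1) ≤ 0 := by
    have hy1 : 0 < 1 - y := by linarith
    have : x * (z / y - 1) + (1 - x) * ((1 - z) / (1 - y) - 1)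
        = -((y - z) * (x - y)) / (y * (1 - y)) := by field_simp; ring
    rw [this, neg_div, neg_nonpos]
    have := sub_nonneg.mpr a2
    have := sub_nonneg.mpr a3
    positivity
  unfold binRelEntropy
  linarith

/-- Lower semicontinuity of the binary divergence along increasing limits of the first argument. -/
lemma bernKL_iSup_le {ι : Type*} (p : ι → ℝ≥0∞) {q C : ℝ≥0∞} (hp : ∀ i, p i ≤ 1)
    (hq : q ≤ ⨆ i, p i) (h : ∀ i, q ≤ p i → bernKL (p i) q ≤ C) : bernKL (⨆ i, p i) q ≤ C := by
  have hs1 : (⨆ i, p i) ≤ 1 := iSup_le hp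
  rcases hq.eq_or_lt with heq | hlt
  · rw [← heq, bernKL_self (heq ▸ hs1)]; exact zero_le
  rcases eq_or_ne q 0 with rfl | h0
  · obtain ⟨i, hi⟩ := lt_iSup_iff.mp hlt
    have := h i zero_le
    rw [bernKL_zero_right hi.ne'] at this
    exact le_top.trans this
  have hq1 : q < 1 := hlt.trans_le hs1
  have hcont : Filter.Tendsto (fun x : ℝ≥0∞ => ENNReal.ofReal (binRelEntropy x.toReal q.toReal))
      (𝓝 (⨆ i, p i)) (𝓝 (ENNReal.ofReal (binRelEntropy (⨆ i, p i).toReal q.toReal))) :=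
    (ENNReal.continuous_ofReal.comp (continuous_binRelEntropy_left _)).continuousAt.tendsto.comp
      (ENNReal.tendsto_toReal (hs1.trans_lt ENNReal.one_lt_top).ne)
  rw [bernKL_eq_ofReal hs1 h0 hq1]
  refine le_of_tendsto_of_frequently hcont ?_
  have : Nonempty ι := by
    obtain ⟨i, -⟩ := lt_iSup_iff.mp hlt
    exact ⟨i⟩
  -- The supremum is a limit point of the values of `p`, and near it they exceed `q`, so the
  -- hypothesis applies to them.
  have hfreq : ∃ᶠ x in 𝓝 (⨆ i, p i), x ∈ Set.range p :=
    mem_closure_iff_frequently.mp (isLUB_iSup.mem_closure (Set.range_nonempty p))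
  refine (hfreq.and_eventually (lt_mem_nhds hlt)).mono ?_
  rintro _ ⟨⟨i, rfl⟩, hi⟩
  rw [← bernKL_eq_ofReal (hp i) h0 hq1]
  exact h i hi.le

end Bernoulli

/-! ### From mutual information to success rates -/

section Attack

open InformationTheory

variable {m : ℕ} {O A : Type*} [MeasurableSpace O] [MeasurableSpace A]

lemma measurable_success {succ : Fin m → A → Prop} (hsucc : ∀ j, MeasurableSet {a | succ j a})
    (κ : Kernel O A) : Measurable fun x : Fin m × O => κ x.2 {a | succ x.1 a} :=
  measurable_from_prod_countable_right fun j => κ.measurable_coe (hsucc j)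

lemma posteriorRate_le_one (μ : Measure (Fin m × O)) [IsProbabilityMeasure μ]
    (succ : Fin m → A → Prop) (κ : Kernel O A) [IsMarkovKernel κ] :
    posteriorRate μ succ κ ≤ 1 :=
  (lintegral_mono fun _ => prob_le_one).trans (by simp)

/-- When the observation is independent of the secret, each value `o` merely selects the blind
answer `κ o`. -/
lemma posteriorRate_prod_le_priorRate (μ : Measure (Fin m × O)) [IsProbabilityMeasure μ]
    {succ : Fin m → A → Prop} (hsucc : ∀ j, MeasurableSet {a | succ j a}) (κ : Kernel O A)
    [IsMarkovKernel κ] :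
    posteriorRate (μ.fst.prod μ.snd) succ κ ≤ priorRate μ succ := by
  rw [posteriorRate, lintegral_prod_symm' _ (measurable_success hsucc κ)]
  calc ∫⁻ o, ∫⁻ j, κ o {a | succ j a} ∂μ.fst ∂μ.snd ≤ ∫⁻ _, priorRate μ succ ∂μ.snd :=
        lintegral_mono fun o => le_iSup
          (fun ν : ProbabilityMeasure A => ∫⁻ j, (ν : Measure A) {a | succ j a} ∂μ.fst)
          ⟨κ o, inferInstance⟩
    _ = _ := by simp

/-- Data processing for the channel `η` that emits the success bit: given secret and observation,
this bit is Bernoulli with the conditional success probability. -/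
lemma bernKL_posteriorRate_le_klDiv (μ ν : Measure (Fin m × O)) [IsProbabilityMeasure μ]
    [IsProbabilityMeasure ν] {succ : Fin m → A → Prop}
    (hsucc : ∀ j, MeasurableSet {a | succ j a}) (κ : Kernel O A) [IsMarkovKernel κ] :
    bernKL (posteriorRate μ succ κ) (posteriorRate ν succ κ) ≤ klDiv μ ν := by
  have hm := measurable_success hsucc κ
  let η : Kernel (Fin m × O) Bool :=
    ⟨fun x => bern (κ x.2 {a | succ x.1 a}), measurable_bern.comp hm⟩
  have : IsMarkovKernel η := ⟨fun x => isProbabilityMeasure_bern prob_le_one⟩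
  have key (ρ : Measure (Fin m × O)) [IsProbabilityMeasure ρ] :
      η ∘ₘ ρ = bern (posteriorRate ρ succ κ) := by
    have := isProbabilityMeasure_bern (posteriorRate_le_one ρ succ κ)
    have ht : (η ∘ₘ ρ) {true} = bern (posteriorRate ρ succ κ) {true} := by
      rw [Measure.bind_apply (.singleton _) η.aemeasurable]
      simp [η, bern, posteriorRate]
    refine Measure.ext_of_singleton fun b => ?_
    cases b
    · have : ({false} : Set Bool) = {true}ᶜ := by ext b; cases b <;> simp
      rw [this, prob_compl_eq_one_sub (.singleton _), prob_compl_eq_one_sub (.singleton _), ht]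
    · exact ht
  rw [bernKL, ← key, ← key]
  exact klDiv_comp_right_le _ _ η

/-- Fano-type inequality for an arbitrary attack. -/
lemma bernKL_posteriorRate_le_mutualInfo (μ : Measure (Fin m × O)) [IsProbabilityMeasure μ]
    {succ : Fin m → A → Prop} (hsucc : ∀ j, MeasurableSet {a | succ j a}) (κ : Kernel O A)
    [IsMarkovKernel κ] (h : priorRate μ succ ≤ posteriorRate μ succ κ) :
    bernKL (posteriorRate μ succ κ) (priorRate μ succ) ≤ mutualInfo μ :=
  (bernKL_anti_right (posteriorRate_le_one μ succ κ) h
    (posteriorRate_prod_le_priorRate μ hsucc κ)).trans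
    (bernKL_posteriorRate_le_klDiv _ _ hsucc κ)

/-- A blind answer is an adversary that ignores the observation. -/
lemma priorRate_le_optPosteriorRate (μ : Measure (Fin m × O)) (succ : Fin m → A → Prop) :
    priorRate μ succ ≤ optPosteriorRate μ succ := by
  refine iSup_le fun ν => le_iSup_of_le ⟨Kernel.const O (ν : Measure A), inferInstance⟩ ?_
  rw [posteriorRate, Measure.fst, lintegral_map (measurable_of_countable _) measurable_fst]
  rfl

lemma bernKL_optPosteriorRate_le_mutualInfo (μ : Measure (Fin m × O)) [IsProbabilityMeasure μ]
    {succ : Fin m → A → Prop} (hsucc : ∀ j, MeasurableSet {a | succ j a}) :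
    bernKL (optPosteriorRate μ succ) (priorRate μ succ) ≤ mutualInfo μ :=
  bernKL_iSup_le _ (fun κ => have := κ.2; posteriorRate_le_one μ succ κ.1)
    (priorRate_le_optPosteriorRate μ succ)
    fun κ h => have := κ.2; bernKL_posteriorRate_le_mutualInfo μ hsucc κ.1 h

end Attack

/-! ### Laws depending on a parameter -/

section ParametrizedLaw

variable {X Y Z : Type*} [MeasurableSpace X] [MeasurableSpace Y] [MeasurableSpace Z]

/-- The law of `F x` under `ρ`, as a kernel in the parameter `x`. -/
noncomputable def paramLaw (ρ : Measure Z) (F : X → Z → Y) : Kernel X Y :=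
  (Kernel.id ×ₖ Kernel.const X ρ).map (Function.uncurry F)

lemma paramLaw_apply (ρ : Measure Z) [SFinite ρ] {F : X → Z → Y}
    (hF : Measurable (Function.uncurry F)) (x : X) : paramLaw ρ F x = ρ.map (F x) := by
  rw [paramLaw, Kernel.map_apply _ hF, Kernel.prod_apply, Kernel.id_apply, Kernel.const_apply,
    Measure.dirac_prod, Measure.map_map hF measurable_prodMk_left]
  rfl

lemma isMarkovKernel_paramLaw (ρ : Measure Z) [IsProbabilityMeasure ρ] {F : X → Z → Y}
    (hF : Measurable (Function.uncurry F)) : IsMarkovKernel (paramLaw ρ F) :=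
  Kernel.IsMarkovKernel.map _ hF

lemma compProd_paramLaw (ν : Measure X) [IsProbabilityMeasure ν] (ρ : Measure Z)
    [IsProbabilityMeasure ρ] {F : X → Z → Y} (hF : Measurable (Function.uncurry F)) :
    ν ⊗ₘ paramLaw ρ F = (ν.prod ρ).map fun p => (p.1, F p.1 p.2) := by
  have := isMarkovKernel_paramLaw ρ hF
  have hm : Measurable fun p : X × Z => (p.1, F p.1 p.2) := measurable_fst.prodMk hF
  ext s hs
  rw [Measure.compProd_apply hs, Measure.map_apply hm hs, Measure.prod_apply (hm hs)]
  refine lintegral_congr fun x => ?_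
  rw [paramLaw_apply ρ hF, Measure.map_apply hF.of_uncurry_left (measurable_prodMk_left hs)]
  rfl

end ParametrizedLaw

/-! ### Gaussian noise -/

section Gaussian

open InformationTheory
open scoped NNReal

lemma gaussianReal_map_const_add_mul (a : ℝ) {Δ : ℝ} (hΔ : 0 ≤ Δ) :
    (gaussianReal 0 1).map (fun z => a + Real.sqrt Δ * z) = gaussianReal a Δ.toNNReal := by
  have : (fun z => a + Real.sqrt Δ * z) = (fun x => a + x) ∘ (fun z => Real.sqrt Δ * z) := rfl
  rw [this, ← Measure.map_map (by fun_prop) (by fun_prop), gaussianReal_map_const_mul,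
    gaussianReal_map_const_add]
  congr 1
  · simp
  · ext
    simp [Real.sq_sqrt hΔ, hΔ]

/-- For equal variances the quadratic terms cancel, so the log-likelihood ratio is affine and its
expectation needs only the mean. -/
lemma klDiv_gaussianReal (a b : ℝ) {v : ℝ≥0} (hv : v ≠ 0) :
    klDiv (gaussianReal a v) (gaussianReal b v) = ENNReal.ofReal ((a - b) ^ 2 / (2 * v)) := by
  have hac : gaussianReal a v ≪ gaussianReal b v :=
    (gaussianReal_absolutelyContinuous a hv).trans (gaussianReal_absolutelyContinuous' b hv)
  have hv' : (0 : ℝ) < v := by positivity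
  have hrn : (gaussianReal a v).rnDeriv (gaussianReal b v) =ᵐ[gaussianReal b v]
      fun x => (gaussianPDF b v x)⁻¹ * gaussianPDF a v x := by
    have h1 := Measure.rnDeriv_withDensity_right (gaussianReal a v) volume
      (f := gaussianPDF b v) (by fun_prop)
      (Filter.Eventually.of_forall fun x => (gaussianPDF_pos b hv x).ne')
      (Filter.Eventually.of_forall fun x => gaussianPDF_ne_top)
    rw [← gaussianReal_of_var_ne_zero b hv] at h1
    refine (gaussianReal_absolutelyContinuous b hv).ae_le ?_
    filter_upwards [h1, rnDeriv_gaussianReal a v] with x hx hx'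
    rw [hx, hx']
  have hllr : llr (gaussianReal a v) (gaussianReal b v) =ᵐ[gaussianReal a v]
      fun x => (a - b) / v * x + (b ^ 2 - a ^ 2) / (2 * v) := by
    filter_upwards [hac.ae_le hrn] with x hx
    rw [llr, hx, ENNReal.toReal_mul, ENNReal.toReal_inv, toReal_gaussianPDF, toReal_gaussianPDF,
      Real.log_mul (inv_ne_zero (gaussianPDFReal_pos _ _ _ hv).ne')
        (gaussianPDFReal_pos _ _ _ hv).ne', Real.log_inv, gaussianPDFReal, gaussianPDFReal,
      Real.log_mul (by positivity) (by positivity), Real.log_mul (by positivity) (by positivity),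
      Real.log_exp, Real.log_exp]
    field_simp
    ring
  have hid : Integrable (fun x : ℝ => x) (gaussianReal a v) :=
    (memLp_id_gaussianReal 1).integrable le_rfl
  have hint : Integrable (fun x => (a - b) / v * x + (b ^ 2 - a ^ 2) / (2 * v))
      (gaussianReal a v) := (hid.const_mul _).add (integrable_const _)
  rw [klDiv_of_ac_of_integrable hac ((integrable_congr hllr).mpr hint), integral_congr_ae hllr,
    integral_add (hid.const_mul _) (integrable_const _), integral_const_mul,
    integral_id_gaussianReal]
  congr 1
  simp only [integral_const, probReal_univ, smul_eq_mul]
  field_simp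
  ring

end Gaussian

/-! ### Divergence between the mechanism and its reference -/

section Mechanism

open InformationTheory

variable {m : ℕ}

/-- The state of `pac_noised` after the value `x` has been released. -/
noncomputable def stateUpdate (B : ℝ) (P y : Fin m → ℝ) (x : ℝ) : Fin m → ℝ := fun j =>
  P j * Real.exp (-(x - y j) ^ 2 / (2 * noiseVar B P y)) /
    ∑ i, P i * Real.exp (-(x - y i) ^ 2 / (2 * noiseVar B P y))

/-- The mechanism with an arbitrary function `ctr` of the state and of the cell vector instead of
the secret component as the centre of the noise. -/
noncomputable def releasedCells (B : ℝ) (ctr : (Fin m → ℝ) → (Fin m → ℝ) → ℝ) :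
    (N : ℕ) → (Fin m → ℝ) → (Fin N → Fin m → ℝ) → (Fin N → ℝ) → (Fin N → ℝ)
  | 0, _, _, _ => Fin.elim0
  | N + 1, P, y, z =>
      Fin.cons (ctr P (y 0) + Real.sqrt (noiseVar B P (y 0)) * z 0)
        (releasedCells B ctr N
          (stateUpdate B P (y 0) (ctr P (y 0) + Real.sqrt (noiseVar B P (y 0)) * z 0))
          (fun i => y i.succ) (fun i => z i.succ))

lemma noisedCells_eq_releasedCells (B : ℝ) (j : Fin m) (N : ℕ) (P : Fin m → ℝ)
    (y : Fin N → Fin m → ℝ) (z : Fin N → ℝ) :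
    noisedCells B j N P y z = releasedCells B (fun _ y => y j) N P y z := by
  induction N generalizing P with
  | zero => rfl
  | succ N ih =>
    rw [noisedCells, releasedCells, ih]
    rfl

lemma measurable_noiseVar (B : ℝ) (y : Fin m → ℝ) : Measurable fun P => noiseVar B P y := by
  unfold noiseVar varianceUnder
  fun_prop

lemma measurable_stateUpdate (B : ℝ) (y : Fin m → ℝ) :
    Measurable fun p : (Fin m → ℝ) × ℝ => stateUpdate B p.1 y p.2 := by
  have : Measurable fun p : (Fin m → ℝ) × ℝ => noiseVar B p.1 y :=
    (measurable_noiseVar B y).comp measurable_fst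
  unfold stateUpdate
  fun_prop

/-- Joint measurability is needed because, after one release, the state is itself a function of the
noise. -/
lemma measurable_releasedCells (B : ℝ) {ctr : (Fin m → ℝ) → (Fin m → ℝ) → ℝ}
    (hctr : ∀ y, Measurable fun P => ctr P y) (N : ℕ) (y : Fin N → Fin m → ℝ) :
    Measurable fun p : (Fin m → ℝ) × (Fin N → ℝ) => releasedCells B ctr N p.1 y p.2 := by
  induction N with
  | zero => exact measurable_of_subsingleton_codomain _
  | succ N ih =>
    have hx : Measurable fun p : (Fin m → ℝ) × (Fin (N + 1) → ℝ) =>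
        ctr p.1 (y 0) + Real.sqrt (noiseVar B p.1 (y 0)) * p.2 0 :=
      ((hctr _).comp measurable_fst).add
        (((measurable_noiseVar B (y 0)).comp measurable_fst).sqrt.mul
          ((measurable_pi_apply 0).comp measurable_snd))
    have hrec := (ih fun i => y i.succ).comp
      (((measurable_stateUpdate B (y 0)).comp (measurable_fst.prodMk hx)).prodMk
        (measurable_pi_lambda _ fun i : Fin N => (measurable_pi_apply i.succ).comp measurable_snd))
    refine measurable_pi_lambda _ fun i => ?_
    refine Fin.cases ?_ (fun i => ?_) i
    · exact hx
    · exact (measurable_pi_apply i).comp hrec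

lemma measurable_releasedCells_right (B : ℝ) {ctr : (Fin m → ℝ) → (Fin m → ℝ) → ℝ}
    (hctr : ∀ y, Measurable fun P => ctr P y) (N : ℕ) (P : Fin m → ℝ) (y : Fin N → Fin m → ℝ) :
    Measurable (releasedCells B ctr N P y) :=
  (measurable_releasedCells B hctr N y).comp measurable_prodMk_left

/-- The law of the cells released by the mechanism with centre `ctr`. -/
noncomputable def releaseLaw (B : ℝ) (ctr : (Fin m → ℝ) → (Fin m → ℝ) → ℝ) (N : ℕ)
    (P : Fin m → ℝ) (y : Fin N → Fin m → ℝ) : Measure (Fin N → ℝ) :=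
  (Measure.pi fun _ => gaussianReal 0 1).map (releasedCells B ctr N P y)

lemma isProbabilityMeasure_releaseLaw (B : ℝ) {ctr : (Fin m → ℝ) → (Fin m → ℝ) → ℝ}
    (hctr : ∀ y, Measurable fun P => ctr P y) (N : ℕ) (P : Fin m → ℝ) (y : Fin N → Fin m → ℝ) :
    IsProbabilityMeasure (releaseLaw B ctr N P y) :=
  Measure.isProbabilityMeasure_map
    (measurable_releasedCells_right B hctr N P y).aemeasurable

/-- The law of the later cells, as a kernel in the first released value. -/
noncomputable def laterLaw (B : ℝ) (ctr : (Fin m → ℝ) → (Fin m → ℝ) → ℝ) (N : ℕ)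
    (P y₀ : Fin m → ℝ) (y : Fin N → Fin m → ℝ) : Kernel ℝ (Fin N → ℝ) :=
  paramLaw (Measure.pi fun _ => gaussianReal 0 1)
    fun x z => releasedCells B ctr N (stateUpdate B P y₀ x) y z

lemma measurable_releasedCells_stateUpdate (B : ℝ) {ctr : (Fin m → ℝ) → (Fin m → ℝ) → ℝ}
    (hctr : ∀ y, Measurable fun P => ctr P y) (N : ℕ) (P : Fin m → ℝ) (y₀ : Fin m → ℝ)
    (y : Fin N → Fin m → ℝ) :
    Measurable (Function.uncurry fun (x : ℝ) (z : Fin N → ℝ) =>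
      releasedCells B ctr N (stateUpdate B P y₀ x) y z) :=
  (measurable_releasedCells B hctr N y).comp
    (((measurable_stateUpdate B y₀).comp (measurable_const.prodMk measurable_fst)).prodMk
      measurable_snd)

lemma laterLaw_apply (B : ℝ) {ctr : (Fin m → ℝ) → (Fin m → ℝ) → ℝ}
    (hctr : ∀ y, Measurable fun P => ctr P y) (N : ℕ) (P : Fin m → ℝ) (y₀ : Fin m → ℝ)
    (y : Fin N → Fin m → ℝ) (x : ℝ) :
    laterLaw B ctr N P y₀ y x = releaseLaw B ctr N (stateUpdate B P y₀ x) y :=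
  paramLaw_apply _ (measurable_releasedCells_stateUpdate B hctr N P y₀ y) x

lemma isMarkovKernel_laterLaw (B : ℝ) {ctr : (Fin m → ℝ) → (Fin m → ℝ) → ℝ}
    (hctr : ∀ y, Measurable fun P => ctr P y) (N : ℕ) (P : Fin m → ℝ) (y₀ : Fin m → ℝ)
    (y : Fin N → Fin m → ℝ) :
    IsMarkovKernel (laterLaw B ctr N P y₀ y) :=
  isMarkovKernel_paramLaw _ (measurable_releasedCells_stateUpdate B hctr N P y₀ y)

/-- The later cells depend on the first one only through the state computed from its released value,
and their noise is independent of it. -/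
lemma releaseLaw_succ (B : ℝ) {ctr : (Fin m → ℝ) → (Fin m → ℝ) → ℝ}
    (hctr : ∀ y, Measurable fun P => ctr P y) (N : ℕ) (P : Fin m → ℝ)
    (y : Fin (N + 1) → Fin m → ℝ) (hΔ : 0 ≤ noiseVar B P (y 0)) :
    releaseLaw B ctr (N + 1) P y =
      (gaussianReal (ctr P (y 0)) (noiseVar B P (y 0)).toNNReal ⊗ₘ
        laterLaw B ctr N P (y 0) (fun i => y i.succ)).map
      (MeasurableEquiv.piFinSuccAbove (fun _ => ℝ) 0).symm := by
  have hF := measurable_releasedCells_stateUpdate B hctr N P (y 0) fun i => y i.succ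
  have hG : Measurable fun p : ℝ × (Fin N → ℝ) =>
      (p.1, releasedCells B ctr N (stateUpdate B P (y 0) p.1) (fun i => y i.succ) p.2) :=
    measurable_fst.prodMk hF
  have hx : Measurable fun z : ℝ => ctr P (y 0) + Real.sqrt (noiseVar B P (y 0)) * z := by fun_prop
  rw [laterLaw, compProd_paramLaw _ _ hF, ← gaussianReal_map_const_add_mul _ hΔ,
    ← Measure.map_id (μ := Measure.pi fun _ : Fin N => gaussianReal 0 1),
    Measure.map_prod_map _ _ hx measurable_id,
    Measure.map_map hG (hx.prodMap measurable_id),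
    Measure.map_map (MeasurableEquiv.measurable _)
      (hG.comp (hx.prodMap measurable_id)), releaseLaw,
    ← (measurePreserving_piFinSuccAbove (fun _ : Fin (N + 1) => gaussianReal 0 1) 0).symm.map_eq,
    Measure.map_map (measurable_releasedCells_right B hctr (N + 1) P y)
      (MeasurableEquiv.measurable _)]
  congr 1
  ext p i
  simp [releasedCells, MeasurableEquiv.piFinSuccAbove_symm_apply, Fin.insertNthEquiv, Prod.map]

/-- Full support is an invariant of the induction; it makes the posterior well defined and forces a
vector of zero variance to be constant. -/
lemma stateUpdate_pos (B : ℝ) {P : Fin m → ℝ} (hP : ∀ j, 0 < P j) (y : Fin m → ℝ) (x : ℝ)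
    (j : Fin m) : 0 < stateUpdate B P y x j :=
  div_pos (mul_pos (hP j) (Real.exp_pos _))
    (Finset.sum_pos (fun i _ => mul_pos (hP i) (Real.exp_pos _)) ⟨j, Finset.mem_univ j⟩)

lemma sum_stateUpdate (B : ℝ) {P : Fin m → ℝ} (hP : ∀ j, 0 < P j) (hs : ∑ j, P j = 1)
    (y : Fin m → ℝ) (x : ℝ) : ∑ j, stateUpdate B P y x j = 1 := by
  have : Nonempty (Fin m) := by
    by_contra h
    rw [not_nonempty_iff] at h
    simp at hs
  have hpos : 0 < ∑ i, P i * Real.exp (-(x - y i) ^ 2 / (2 * noiseVar B P y)) :=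
    Finset.sum_pos (fun i _ => mul_pos (hP i) (Real.exp_pos _)) Finset.univ_nonempty
  simp only [stateUpdate]
  rw [← Finset.sum_div, div_self hpos.ne']

lemma varianceUnder_nonneg {P : Fin m → ℝ} (hP : ∀ j, 0 < P j) (y : Fin m → ℝ) :
    0 ≤ varianceUnder P y :=
  Finset.sum_nonneg fun j _ => mul_nonneg (hP j).le (sq_nonneg _)

lemma eq_mean_of_varianceUnder_eq_zero {P : Fin m → ℝ} (hP : ∀ j, 0 < P j) {y : Fin m → ℝ}
    (h : varianceUnder P y = 0) (j : Fin m) : y j = ∑ i, P i * y i := by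
  have := (Finset.sum_eq_zero_iff_of_nonneg
    fun j _ => mul_nonneg (hP j).le (sq_nonneg _)).mp h j (Finset.mem_univ j)
  rcases mul_eq_zero.mp this with h | h
  · exact absurd h (hP j).ne'
  · exact sub_eq_zero.mp (pow_eq_zero_iff two_ne_zero |>.mp h)

/-- Superadditivity of the lower integral needs no measurability, so none has to be shown for
divergences as functions of the released value. -/
lemma sum_lintegral_le_lintegral_sum {ι Z : Type*} [MeasurableSpace Z] (s : Finset ι)
    (μ : Measure Z) (f : ι → Z → ℝ≥0∞) : ∑ i ∈ s, ∫⁻ z, f i z ∂μ ≤ ∫⁻ z, ∑ i ∈ s, f i z ∂μ := by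
  classical
  induction s using Finset.induction_on with
  | empty => simp
  | insert i s hi ih =>
    simp only [Finset.sum_insert hi]
    exact (add_le_add_right ih _).trans (le_lintegral_add _ _)

/-- Bayes' rule: the prior average of conditional expectations given the secret is the average over
the released value of posterior averages. -/
lemma sum_lintegral_gaussianReal_le (B : ℝ) {P : Fin m → ℝ} (hP : ∀ j, 0 < P j)
    (hs : ∑ j, P j = 1) (y : Fin m → ℝ) (hΔ : 0 < noiseVar B P y) (φ : Fin m → ℝ → ℝ≥0∞)
    {C : ℝ≥0∞} (h : ∀ x, ∑ j, ENNReal.ofReal (stateUpdate B P y x j) * φ j x ≤ C) :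
    ∑ j, ENNReal.ofReal (P j) * ∫⁻ x, φ j x ∂gaussianReal (y j) (noiseVar B P y).toNNReal ≤ C := by
  set v := (noiseVar B P y).toNNReal with hv
  have hv0 : v ≠ 0 := (Real.toNNReal_pos.mpr hΔ).ne'
  have hvΔ : (v : ℝ) = noiseVar B P y := Real.coe_toNNReal _ hΔ.le
  -- Prior times likelihood equals marginal density times posterior; the common variance lets the
  -- normalizing constants of the Gaussians cancel in `stateUpdate`.
  have hbayes (x : ℝ) (j : Fin m) : ENNReal.ofReal (P j) * gaussianPDF (y j) v x =
      (∑ i, ENNReal.ofReal (P i) * gaussianPDF (y i) v x) *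
        ENNReal.ofReal (stateUpdate B P y x j) := by
    have hnn (i : Fin m) : 0 ≤ P i * gaussianPDFReal (y i) v x :=
      mul_nonneg (hP i).le (gaussianPDFReal_nonneg _ _ _)
    simp only [gaussianPDF, ← ENNReal.ofReal_mul (hP _).le]
    rw [← ENNReal.ofReal_sum_of_nonneg fun i _ => hnn i,
      ← ENNReal.ofReal_mul (Finset.sum_nonneg fun i _ => hnn i)]
    congr 1
    simp only [gaussianPDFReal, stateUpdate, hvΔ]
    have hpos : 0 < ∑ i, P i * Real.exp (-(x - y i) ^ 2 / (2 * noiseVar B P y)) :=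
      Finset.sum_pos (fun i _ => mul_pos (hP i) (Real.exp_pos _)) ⟨j, Finset.mem_univ j⟩
    have hfac : ∑ i, P i * ((Real.sqrt (2 * Real.pi * noiseVar B P y))⁻¹ *
        Real.exp (-(x - y i) ^ 2 / (2 * noiseVar B P y))) =
        (Real.sqrt (2 * Real.pi * noiseVar B P y))⁻¹ *
          ∑ i, P i * Real.exp (-(x - y i) ^ 2 / (2 * noiseVar B P y)) := by
      rw [Finset.mul_sum]
      exact Finset.sum_congr rfl fun i _ => by ring
    rw [hfac, mul_assoc (Real.sqrt _)⁻¹, mul_div_cancel₀ _ hpos.ne']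
    ring
  calc ∑ j, ENNReal.ofReal (P j) * ∫⁻ x, φ j x ∂gaussianReal (y j) v
      ≤ ∑ j, ∫⁻ x, ENNReal.ofReal (P j) * (gaussianPDF (y j) v x * φ j x) := by
        refine Finset.sum_le_sum fun j _ => ?_
        rw [lintegral_const_mul' _ _ ENNReal.ofReal_ne_top]
        refine mul_le_mul_right ?_ _
        rw [gaussianReal_of_var_ne_zero _ hv0]
        exact lintegral_withDensity_le_lintegral_mul _ (measurable_gaussianPDF _ _) _
    _ ≤ ∫⁻ x, ∑ j, ENNReal.ofReal (P j) * (gaussianPDF (y j) v x * φ j x) :=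
        sum_lintegral_le_lintegral_sum _ _ _
    _ ≤ ∫⁻ x, (∑ i, ENNReal.ofReal (P i) * gaussianPDF (y i) v x) * C := by
        refine lintegral_mono fun x => ?_
        calc ∑ j, ENNReal.ofReal (P j) * (gaussianPDF (y j) v x * φ j x)
            = (∑ i, ENNReal.ofReal (P i) * gaussianPDF (y i) v x) *
                ∑ j, ENNReal.ofReal (stateUpdate B P y x j) * φ j x := by
              rw [Finset.mul_sum]
              refine Finset.sum_congr rfl fun j _ => ?_
              rw [← mul_assoc, ← mul_assoc, hbayes]
          _ ≤ _ := by gcongr; exact h x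
    _ = C := by
        rw [lintegral_mul_const _ (by fun_prop), lintegral_finsetSum _ (by fun_prop)]
        simp only [lintegral_const_mul' _ _ ENNReal.ofReal_ne_top,
          lintegral_gaussianPDF_eq_one _ hv0, mul_one]
        rw [← ENNReal.ofReal_sum_of_nonneg fun i _ => (hP i).le, hs, ENNReal.ofReal_one, one_mul]

/-- The calibration of the noise: the `P`-average of `(y_j - mean)² / (2Δ)` is `Var / (2Δ)`, and `Δ
= Var / (2B)`. -/
lemma sum_klDiv_gaussianReal {B : ℝ} (hB : 0 < B) {P : Fin m → ℝ} (hP : ∀ j, 0 < P j)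
    (y : Fin m → ℝ) (hΔ : 0 < noiseVar B P y) :
    ∑ j, ENNReal.ofReal (P j) * klDiv (gaussianReal (y j) (noiseVar B P y).toNNReal)
      (gaussianReal (∑ i, P i * y i) (noiseVar B P y).toNNReal) = ENNReal.ofReal B := by
  have hv0 : (noiseVar B P y).toNNReal ≠ 0 := (Real.toNNReal_pos.mpr hΔ).ne'
  simp only [klDiv_gaussianReal _ _ hv0, Real.coe_toNNReal _ hΔ.le,
    ← ENNReal.ofReal_mul (hP _).le]
  rw [← ENNReal.ofReal_sum_of_nonneg fun j _ => mul_nonneg (hP j).le (by positivity)]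
  congr 1
  simp only [← mul_div_assoc]
  rw [← Finset.sum_div, ← varianceUnder]
  have hV : varianceUnder P y = noiseVar B P y * (2 * B) := by
    rw [noiseVar]
    field_simp
  rw [hV]
  field_simp

/-- The centre of the noise in the mechanism with secret index `j`. -/
def secretCtr (j : Fin m) : (Fin m → ℝ) → (Fin m → ℝ) → ℝ := fun _ y => y j

/-- The mean of the cell under the current state. -/
def meanCtr : (Fin m → ℝ) → (Fin m → ℝ) → ℝ := fun P y => ∑ i, P i * y i

lemma measurable_secretCtr (j : Fin m) (y : Fin m → ℝ) : Measurable fun P => secretCtr j P y :=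
  measurable_const

lemma measurable_meanCtr (y : Fin m → ℝ) : Measurable fun P => meanCtr P y := by
  unfold meanCtr
  fun_prop

/-- Chain rule: whatever the centre, a released value `x` leads to the same next state, so the
conditional laws compare two mechanisms started from that state. -/
lemma klDiv_releaseLaw_succ_le (B : ℝ) {ctr ctr' : (Fin m → ℝ) → (Fin m → ℝ) → ℝ}
    (hctr : ∀ y, Measurable fun P => ctr P y) (hctr' : ∀ y, Measurable fun P => ctr' P y) (N : ℕ)
    (P : Fin m → ℝ) (y : Fin (N + 1) → Fin m → ℝ) (hΔ : 0 ≤ noiseVar B P (y 0))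
    (hac : ∀ x, releaseLaw B ctr N (stateUpdate B P (y 0) x) (fun i => y i.succ) ≪
      releaseLaw B ctr' N (stateUpdate B P (y 0) x) (fun i => y i.succ)) :
    klDiv (releaseLaw B ctr (N + 1) P y) (releaseLaw B ctr' (N + 1) P y) ≤
      klDiv (gaussianReal (ctr P (y 0)) (noiseVar B P (y 0)).toNNReal)
        (gaussianReal (ctr' P (y 0)) (noiseVar B P (y 0)).toNNReal) +
      ∫⁻ x, klDiv (releaseLaw B ctr N (stateUpdate B P (y 0) x) fun i => y i.succ)
        (releaseLaw B ctr' N (stateUpdate B P (y 0) x) fun i => y i.succ)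
        ∂gaussianReal (ctr P (y 0)) (noiseVar B P (y 0)).toNNReal := by
  have := isMarkovKernel_laterLaw B hctr N P (y 0) fun i => y i.succ
  have := isMarkovKernel_laterLaw B hctr' N P (y 0) fun i => y i.succ
  rw [releaseLaw_succ B hctr N P y hΔ, releaseLaw_succ B hctr' N P y hΔ,
    klDiv_map_measurableEquiv, klDiv_compProd_eq_add, klDiv_compProd_right_eq_lintegral]
  · simp only [laterLaw_apply B hctr, laterLaw_apply B hctr', le_refl]
  · intro x
    rw [laterLaw_apply B hctr, laterLaw_apply B hctr']
    exact hac x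

/-- Every cell increases the divergence from the reference mechanism by at most `B`. -/
theorem sum_klDiv_releaseLaw_le {B : ℝ} (hB : 0 < B) (N : ℕ) (P : Fin m → ℝ)
    (y : Fin N → Fin m → ℝ) (hP : ∀ j, 0 < P j) (hs : ∑ j, P j = 1) :
    ∑ j, ENNReal.ofReal (P j) *
      klDiv (releaseLaw B (secretCtr j) N P y) (releaseLaw B meanCtr N P y) ≤
      N * ENNReal.ofReal B := by
  induction N generalizing P with
  | zero =>
    have (j : Fin m) :
        klDiv (releaseLaw B (secretCtr j) 0 P y) (releaseLaw B meanCtr 0 P y) = 0 := by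
      have := isProbabilityMeasure_releaseLaw B measurable_meanCtr 0 P y
      exact klDiv_self (releaseLaw B meanCtr 0 P y)
    simp [this]
  | succ N ih =>
    have ih' (x : ℝ) := ih (stateUpdate B P (y 0) x) (fun i => y i.succ)
      (stateUpdate_pos B hP (y 0) x) (sum_stateUpdate B hP hs (y 0) x)
    -- The inductive bound is finite and all weights are positive, so each divergence is finite,
    -- which forces absolute continuity.
    have hac (j : Fin m) (x : ℝ) :
        releaseLaw B (secretCtr j) N (stateUpdate B P (y 0) x) (fun i => y i.succ) ≪
          releaseLaw B meanCtr N (stateUpdate B P (y 0) x) (fun i => y i.succ) := by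
      have h1 := (ENNReal.sum_lt_top.mp ((ih' x).trans_lt
        (ENNReal.mul_lt_top (by simp) ENNReal.ofReal_lt_top))) j (Finset.mem_univ j)
      refine (klDiv_ne_top_iff.mp fun h => ?_).1
      rw [h, ENNReal.mul_top] at h1
      · exact lt_irrefl _ h1
      · exact (ENNReal.ofReal_pos.mpr (stateUpdate_pos B hP (y 0) x j)).ne'
    have hΔ : 0 ≤ noiseVar B P (y 0) :=
      div_nonneg (varianceUnder_nonneg hP (y 0)) (by positivity)
    have hstep (j : Fin m) := klDiv_releaseLaw_succ_le B (measurable_secretCtr j)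
      measurable_meanCtr N P y hΔ (hac j)
    have hsum := Finset.sum_le_sum fun j (_ : j ∈ Finset.univ) =>
      mul_le_mul_right (hstep j) (ENNReal.ofReal (P j))
    simp only [mul_add, Finset.sum_add_distrib] at hsum
    refine hsum.trans ?_
    rw [Nat.cast_add, Nat.cast_one, add_mul, one_mul, add_comm]
    -- If `Δ = 0`, the cell is constant by full support, both mechanisms release that constant, and
    -- the cell costs nothing.
    rcases hΔ.eq_or_lt with h0 | hpos
    · have hV : varianceUnder P (y 0) = 0 := by
        rw [noiseVar, eq_comm, div_eq_zero_iff] at h0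
        exact h0.resolve_right (by positivity)
      have hc (j : Fin m) : secretCtr j P (y 0) = meanCtr P (y 0) :=
        eq_mean_of_varianceUnder_eq_zero hP hV j
      simp only [hc, ← h0, Real.toNNReal_zero, gaussianReal_zero_var, klDiv_self, mul_zero,
        Finset.sum_const_zero, add_zero, lintegral_dirac]
      -- Division by zero makes every exponent `0` and every weight `1`, so the state is kept.
      have hupd : stateUpdate B P (y 0) (meanCtr P (y 0)) = P := by
        ext j
        simp [stateUpdate, ← h0, hs]
      have := ih' (meanCtr P (y 0))
      rw [hupd] at this ⊢
      exact this.trans le_self_add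
    · exact add_le_add (sum_lintegral_gaussianReal_le B hP hs (y 0) hpos _ ih')
        (sum_klDiv_gaussianReal hB hP (y 0) hpos).le

end Mechanism

/-! ### The output table and its leakage -/

section Output

open InformationTheory

variable {S : Schema} (Q : Query S) (I : Instance S.toBaseSchema) {m : ℕ}
  (hash : Tuple S.keyArity → Fin m → Bool) (B : ℝ) {N : ℕ} (order : Fin N ≃ Q.Cell I hash)

/-- The law of the output table of the mechanism with centre `ctr`. -/
noncomputable def outputLaw (ctr : (Fin m → ℝ) → (Fin m → ℝ) → ℝ) : Measure (Q.Cell I hash → ℝ) :=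
  (releaseLaw B ctr N (fun _ => 1 / (m : ℝ)) fun i => Q.cellVec I hash (order i)).map
    (MeasurableEquiv.piCongrLeft (fun _ => ℝ) order)

lemma isProbabilityMeasure_outputLaw {ctr : (Fin m → ℝ) → (Fin m → ℝ) → ℝ}
    (hctr : ∀ y, Measurable fun P => ctr P y) :
    IsProbabilityMeasure (outputLaw Q I hash B order ctr) := by
  have := isProbabilityMeasure_releaseLaw B hctr N (fun _ => 1 / (m : ℝ))
    fun i => Q.cellVec I hash (order i)
  exact Measure.isProbabilityMeasure_map (MeasurableEquiv.measurable _).aemeasurable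

/-- Passing from cells to processing positions permutes noise and output alike; since i.i.d. noise
is invariant under relabelling, the output law is that of the sequential mechanism. -/
lemma simdOutput_comp_piCongrLeft (j : Fin m) :
    Q.simdOutput I hash B order j ∘ MeasurableEquiv.piCongrLeft (fun _ => ℝ) order =
      MeasurableEquiv.piCongrLeft (fun _ => ℝ) order ∘
        releasedCells B (secretCtr j) N (fun _ => 1 / (m : ℝ))
          fun i => Q.cellVec I hash (order i) := by
  ext z x
  obtain ⟨i, rfl⟩ := order.surjective x
  simp only [Function.comp_apply, Query.simdOutput, MeasurableEquiv.coe_piCongrLeft,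
    Equiv.piCongrLeft_apply_apply, Equiv.symm_apply_apply, noisedCells_eq_releasedCells]
  rfl

lemma measurable_simdOutput (j : Fin m) : Measurable (Q.simdOutput I hash B order j) := by
  rw [← (MeasurableEquiv.piCongrLeft (fun _ => ℝ) order).measurable_comp_iff,
    simdOutput_comp_piCongrLeft]
  exact (MeasurableEquiv.measurable _).comp
    (measurable_releasedCells_right B (measurable_secretCtr j) _ _ _)

lemma map_simdOutput (j : Fin m) :
    (Measure.pi fun _ : Q.Cell I hash => gaussianReal 0 1).map (Q.simdOutput I hash B order j) =
      outputLaw Q I hash B order (secretCtr j) := by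
  rw [← (measurePreserving_piCongrLeft (fun _ : Q.Cell I hash => gaussianReal 0 1) order).map_eq,
    Measure.map_map (measurable_simdOutput Q I hash B order j) (MeasurableEquiv.measurable _),
    simdOutput_comp_piCongrLeft, outputLaw, releaseLaw, Measure.map_map
      (MeasurableEquiv.measurable _)
      (measurable_releasedCells_right B (measurable_secretCtr j) _ _ _)]

/-- The output law as a kernel in the secret index. -/
noncomputable def outputKernel : Kernel (Fin m) (Q.Cell I hash → ℝ) :=
  ⟨fun j => outputLaw Q I hash B order (secretCtr j), measurable_of_countable _⟩

instance : IsMarkovKernel (outputKernel Q I hash B order) :=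
  ⟨fun j => isProbabilityMeasure_outputLaw Q I hash B order (measurable_secretCtr j)⟩

lemma simdLaw_eq_compProd [NeZero m] : Q.simdLaw I hash B order =
    (PMF.uniformOfFintype (Fin m)).toMeasure ⊗ₘ outputKernel Q I hash B order := by
  have hm : Measurable fun ω : Fin m × (Q.Cell I hash → ℝ) => Q.simdOutput I hash B order ω.1 ω.2 :=
    measurable_from_prod_countable_right fun j => measurable_simdOutput Q I hash B order j
  have hK : outputKernel Q I hash B order = paramLaw
      (Measure.pi fun _ : Q.Cell I hash => gaussianReal 0 1) (Q.simdOutput I hash B order) := by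
    ext1 j
    rw [paramLaw_apply _ hm, map_simdOutput]
    rfl
  rw [hK, compProd_paramLaw _ _ hm]
  rfl

instance [NeZero m] : IsProbabilityMeasure (Q.simdLaw I hash B order) := by
  rw [simdLaw_eq_compProd]
  infer_instance

/-- The output of SIMD-PAC-DB leaks at most `B` nats for each released cell. -/
theorem mutualInfo_simdLaw_le [NeZero m] (hB : 0 < B) :
    mutualInfo (Q.simdLaw I hash B order) ≤ ENNReal.ofReal (N * B) := by
  have hm0 : (0 : ℝ) < m := Nat.cast_pos.mpr (NeZero.pos m)
  have hP : ∀ _ : Fin m, (0 : ℝ) < 1 / m := fun _ => by positivity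
  have hs : ∑ _ : Fin m, 1 / (m : ℝ) = 1 := by simp [hm0.ne']
  have hbound := sum_klDiv_releaseLaw_le hB N (fun _ => 1 / (m : ℝ))
    (fun i => Q.cellVec I hash (order i)) hP hs
  have hR := isProbabilityMeasure_outputLaw Q I hash B order measurable_meanCtr
  have hkl (j : Fin m) : klDiv (outputKernel Q I hash B order j)
      (outputLaw Q I hash B order meanCtr) =
      klDiv (releaseLaw B (secretCtr j) N (fun _ => 1 / (m : ℝ))
        fun i => Q.cellVec I hash (order i)) (releaseLaw B meanCtr N (fun _ => 1 / (m : ℝ))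
        fun i => Q.cellVec I hash (order i)) := by
    have := isProbabilityMeasure_releaseLaw B (measurable_secretCtr j) N (fun _ => 1 / (m : ℝ))
      fun i => Q.cellVec I hash (order i)
    have := isProbabilityMeasure_releaseLaw B measurable_meanCtr N (fun _ => 1 / (m : ℝ))
      fun i => Q.cellVec I hash (order i)
    exact klDiv_map_measurableEquiv _ _ _
  have hac (j : Fin m) : outputKernel Q I hash B order j ≪
      Kernel.const (Fin m) (outputLaw Q I hash B order meanCtr) j := by
    have h1 := (ENNReal.sum_lt_top.mp (hbound.trans_lt
      (ENNReal.mul_lt_top (by simp) ENNReal.ofReal_lt_top))) j (Finset.mem_univ j)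
    refine (klDiv_ne_top_iff.mp fun h => ?_).1
    rw [Kernel.const_apply, hkl] at h
    rw [h, ENNReal.mul_top (ENNReal.ofReal_pos.mpr (hP j)).ne'] at h1
    exact lt_irrefl _ h1
  calc mutualInfo (Q.simdLaw I hash B order)
      ≤ klDiv (Q.simdLaw I hash B order)
          ((Q.simdLaw I hash B order).fst.prod (outputLaw Q I hash B order meanCtr)) :=
        mutualInfo_le_klDiv_prod _ _
    _ = ∑ j, ENNReal.ofReal (1 / (m : ℝ)) *
          klDiv (releaseLaw B (secretCtr j) N (fun _ => 1 / (m : ℝ))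
            fun i => Q.cellVec I hash (order i)) (releaseLaw B meanCtr N (fun _ => 1 / (m : ℝ))
            fun i => Q.cellVec I hash (order i)) := by
        -- The uniform law of `j*` supplies the weights `1 / m`, which are also the initial state,
        -- as the bound `hbound` requires.
        rw [simdLaw_eq_compProd, Measure.fst_compProd, ← Measure.compProd_const,
          klDiv_compProd_right_eq_lintegral _ _ _ hac, lintegral_fintype]
        refine Finset.sum_congr rfl fun j _ => ?_
        rw [Kernel.const_apply, hkl, PMF.toMeasure_apply_singleton _ _ (.singleton _),
          PMF.uniformOfFintype_apply, Fintype.card_fin, mul_comm, one_div,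
          ENNReal.ofReal_inv_of_pos hm0, ENNReal.ofReal_natCast]
    _ ≤ N * ENNReal.ofReal B := hbound
    _ = ENNReal.ofReal (N * B) := by
        rw [ENNReal.ofReal_mul (Nat.cast_nonneg N), ENNReal.ofReal_natCast]

end Output

end SimdPac

theorem mainTheorem2
    (S : SimdPac.Schema) (I : SimdPac.Instance S.toBaseSchema) (Q : SimdPac.Query S)
    {m : ℕ} [NeZero m] {HashKey : Type*}
    (pacHash : HashKey → SimdPac.Tuple S.keyArity → Fin m → Bool) (K : HashKey)
    (B : ℝ) (hB : 0 < B)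
    {c : ℕ} (order : Fin c ≃ Q.Cell I (pacHash K))
    {A : Type*} [MeasurableSpace A] (succ : Fin m → A → Prop)
    (hsucc : ∀ j, MeasurableSet {a | succ j a}) :
    (∀ κ : ProbabilityTheory.Kernel (Q.Cell I (pacHash K) → ℝ) A,
      ProbabilityTheory.IsMarkovKernel κ →
      SimdPac.priorRate (Q.simdLaw I (pacHash K) B order) succ ≤
        SimdPac.posteriorRate (Q.simdLaw I (pacHash K) B order) succ κ →
      SimdPac.bernKL (SimdPac.posteriorRate (Q.simdLaw I (pacHash K) B order) succ κ)
          (SimdPac.priorRate (Q.simdLaw I (pacHash K) B order) succ) ≤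
        SimdPac.mutualInfo (Q.simdLaw I (pacHash K) B order)) ∧
    SimdPac.bernKL (SimdPac.optPosteriorRate (Q.simdLaw I (pacHash K) B order) succ)
        (SimdPac.priorRate (Q.simdLaw I (pacHash K) B order) succ) ≤
      SimdPac.mutualInfo (Q.simdLaw I (pacHash K) B order) ∧
    SimdPac.mutualInfo (Q.simdLaw I (pacHash K) B order) ≤ ENNReal.ofReal ((c : ℝ) * B) := by
  exact ⟨fun κ _ h => SimdPac.bernKL_posteriorRate_le_mutualInfo _ hsucc κ h,
    SimdPac.bernKL_optPosteriorRate_le_mutualInfo _ hsucc,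
    SimdPac.mutualInfo_simdLaw_le Q I (pacHash K) B order hB⟩
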